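/- A planar convex body is a compact convex set $K\subset\mathbb{R}^2$ with non-empty interior; $\mathrm{diam}(K)$ is the maximal length of a segment contained in $K$, and a diameter of $K$ is a segment in $K$ of that length. For $z\in\mathbb{R}^2$ let $$K^z=\{y\in\mathbb{R}^2 : \langle x-z,y\rangle\le 1\ \text{ for all } x\in K\}$$ be the polar of $K$ about $z$. A closed generalized billiard trajectory of a closed convex set $C\subseteq\mathbb{R}^2$ (not necessarily bounded) is a non-constant closed polygonal curve contained in $C$ such that each point at which its direction changes lies on $\partial C$, and there the outgoing direction is the mirror image of the incoming direction in one of the supporting lines of $C$ through that point. Let $\alpha(C)\in[0,\infty]$ be the infimum of the lengths of the closed generalized billiard trajectories of $C$ (the length of a shortest one, whenever there is a shortest one), with $\alpha(C)=\infty$ if there are none, and let $\beta(K)=\inf_{z\in\mathbb{R}^2}\alpha(K)\,\alpha(K^z)$. **Theorem.** For every planar convex body $K$, $$\inf_{z\in\mathbb{R}^2}\alpha(K^z)=\frac{8}{\mathrm{diam}(K)},$$ and the infimum is attained whenever $z$ is the midpoint of a diameter of $K$. Consequently $$\beta(K)=\frac{8\,\alpha(K)}{\mathrm{diam}(K)}.$$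 -/

import Mathlib

open scoped ENNReal

noncomputable section

namespace BilliardPolar

variable {E : Type*} [NormedAddCommGroup E] [InnerProductSpace ℝ E]

/-- The dual (polar) of `K` with respect to the point `z`. -/
def polarAbout (K : Set E) (z : E) : Set E :=
  {y | ∀ x ∈ K, inner ℝ (x - z) y ≤ 1}

/-- `n` is an outer unit normal of a supporting hyperplane of `K` through the point `p ∈ K`:
the hyperplane `{x | ⟪n, x⟫ = ⟪n, p⟫}` meets `K` in `p`, and `K` lies in one of its closed
half-spaces. -/
def IsOuterUnitNormal (K : Set E) (p n : E) : Prop :=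
  p ∈ K ∧ ‖n‖ = 1 ∧ ∀ x ∈ K, inner ℝ n x ≤ inner ℝ n p

/-- The unit direction of the edge from `q i` to `q (i + 1)` of a closed polygonal curve
(indices are cyclic). -/
def edgeDir {m : ℕ} (q : Fin (m + 1) → E) (i : Fin (m + 1)) : E :=
  ‖q (i + 1) - q i‖⁻¹ • (q (i + 1) - q i)

/-- The length of a closed polygonal curve with cyclically indexed vertices `q 0, …, q m`. -/
def closedLength {m : ℕ} (q : Fin (m + 1) → E) : ℝ :=
  ∑ i, dist (q i) (q (i + 1))

/-- The closed polygonal curve with cyclically indexed vertices `q 0, …, q m` (successive vertices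
being distinct, so that the curve is not constant) is a closed generalized billiard trajectory
of `K`: it is contained in `K`, and each point where it is not smooth (a vertex at which the
direction changes) is a boundary point of `K` at which the outgoing direction is the mirror image
of the incoming one in one of the supporting hyperplanes of `K` through that point. -/
structure IsClosedBilliardTrajectory (K : Set E) {m : ℕ} (q : Fin (m + 1) → E) : Prop where
  ne_succ : ∀ i, q i ≠ q (i + 1)
  segment_subset : ∀ i, segment ℝ (q i) (q (i + 1)) ⊆ K
  reflect : ∀ i, edgeDir q (i - 1) ≠ edgeDir q i →
    q i ∈ frontier K ∧ ∃ n : E, IsOuterUnitNormal K (q i) n ∧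
      edgeDir q i = edgeDir q (i - 1) - (2 * inner ℝ n (edgeDir q (i - 1))) • n

/-- `α(K)`: the infimum of the lengths of the closed generalized billiard trajectories of `K`;
it is `∞` if there are none. -/
def shortestBilliard (K : Set E) : ℝ≥0∞ :=
  ⨅ (m : ℕ) (q : Fin (m + 1) → E) (_ : IsClosedBilliardTrajectory K q),
    ENNReal.ofReal (closedLength q)

/-- The billiard product `β(K)`. -/
def billiardProduct (K : Set E) : ℝ≥0∞ :=
  ⨅ z : E, shortestBilliard K * shortestBilliard (polarAbout K z)

end BilliardPolar

end

/-!
The polar `C = K^z` contains a neighbourhood of `0`, wherever `z` lies, so by separation every outer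
normal of `C` at `q` is a multiple `t (x - z)` with `x ∈ K` and `0 ≤ t ≤ ⟪n, q⟫`
(`exists_eq_smul_of_outer_normal_polarAbout`). At a vertex `qᵢ` of a billiard trajectory of `C` the
change of the unit direction, `dᵢ₋₁ - dᵢ`, is a nonnegative multiple of an outer normal, hence
equals `νᵢ xᵢ` with `xᵢ ∈ K - z`; and the length is `∑ ⟪qᵢ, dᵢ₋₁ - dᵢ⟫ ≥ ∑ νᵢ` by summation
by parts. The lower bound `8 / diam K` is thus a statement about the closed polygon of directions
`dᵢ`, inscribed in the unit circle: its edges are `νᵢ xᵢ`, the points `xᵢ` lie in a convex set of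
diameter `D`, and `0` is in the convex hull of the `dᵢ` because the trajectory closes up.

By Carathéodory's theorem three of the `dᵢ` have `0` in their convex hull. Merging the edges between
them replaces the `xᵢ` by convex combinations and keeps `∑ νᵢ` (`eight_le_of_polygon`), which leaves
a non-obtuse triangle `abc` with circumradius `1` and edges `νₖ yₖ` (`eight_le_of_triangle`). Let
`βₖ` be half the squared length of the `k`-th edge and `rₖ` the projection of `yₖ` on the vertex
where the edge starts. Then `νₖ rₖ = βₖ`, and projecting `yⱼ - yₖ` on the common vertex of the two
edges gives `rₖ + rⱼ ≤ D`. Non-obtuseness makes the `βₖ` satisfy the triangle inequality, so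
`∑ βₖ rₖ ≤ D ∑ βₖ / 2`; the orthocentre `a + b + c` has norm at most `1`, so `∑ βₖ ≥ 4`. The
Cauchy-Schwarz inequality now yields `∑ νₖ ≥ (∑ βₖ)² / ∑ βₖ rₖ ≥ 2 ∑ βₖ / D ≥ 8 / D`.

For equality let `z` be the midpoint of a diameter. `K` lies between the normals to the diameter at
its endpoints, so the points of the line through `0` parallel to the diameter at distance
`2 / diam K` from `0` belong to `K^z`; they lie on the supporting lines of `K^z` that are dual to
the endpoints. Running twice through the segment between them is a billiard trajectory of length
`8 / diam K` (`exists_trajectory_of_diameter`).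
-/

namespace BilliardPolar

/-! ### Triangles inscribed in a unit circle and containing its centre -/

section Triangle

variable {E : Type*} [NormedAddCommGroup E] [InnerProductSpace ℝ E]

/-- If `0` is a convex combination of the unit vectors `a, b, c`, then the triangle `abc` is not
obtuse at `c` (first inequality) and its orthocentre `a + b + c` lies in the unit ball (second
inequality). -/
lemma inner_bounds_of_zero_mem_triangle {a b c : E} {p q r : ℝ} (ha : ‖a‖ = 1) (hb : ‖b‖ = 1)
    (hc : ‖c‖ = 1) (hp : 0 ≤ p) (hq : 0 ≤ q) (hr : 0 ≤ r) (hsum : p + q + r = 1)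
    (h0 : p • a + q • b + r • c = 0) :
    0 ≤ 1 + inner ℝ a b - inner ℝ b c - inner ℝ c a ∧
      1 + inner ℝ a b + inner ℝ b c + inner ℝ c a ≤ 0 := by
  have h1 : p + q * inner ℝ a b + r * inner ℝ c a = 0 := by
    have := congrArg (fun v => inner ℝ a v) h0
    simpa [inner_add_right, inner_smul_right, ha, real_inner_comm a c] using this
  have h2 : p * inner ℝ a b + q + r * inner ℝ b c = 0 := by
    have := congrArg (fun v => inner ℝ b v) h0
    simpa [inner_add_right, inner_smul_right, hb, real_inner_comm b a] using this
  have h3 : p * inner ℝ c a + q * inner ℝ b c + r = 0 := by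
    have := congrArg (fun v => inner ℝ c v) h0
    simpa [inner_add_right, inner_smul_right, hc, real_inner_comm c b] using this
  have hsq : ‖a + b‖ ^ 2 = 2 + 2 * inner ℝ a b := by
    rw [norm_add_sq_real, ha, hb]; ring
  have hx1 : -1 ≤ inner ℝ a b := by nlinarith [sq_nonneg ‖a + b‖]
  have hx2 : inner ℝ a b ≤ 1 := by
    simpa [ha, hb] using real_inner_le_norm a b
  rcases hr.eq_or_lt with hr0 | hrpos
  · -- For `r = 0` the vectors `a` and `b` are antipodal, and both bounds are equalities.
    subst hr0
    have hx : inner ℝ a b = -1 := by nlinarith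
    have hab : a + b = 0 := by
      rw [← norm_eq_zero]
      have : ‖a + b‖ ^ 2 = 0 := by rw [hsq, hx]; ring
      exact pow_eq_zero_iff (two_ne_zero) |>.1 this
    have hyw : inner ℝ b c + inner ℝ c a = 0 := by
      rw [real_inner_comm c b, ← inner_add_right, add_comm, hab, inner_zero_right]
    constructor <;> linarith
  · have hrpq : r ≤ p + q := by
      have hrc : r • c = -(p • a + q • b) := by
        rw [eq_neg_iff_add_eq_zero, add_comm, h0]
      calc r = ‖r • c‖ := by rw [norm_smul, hc, mul_one, Real.norm_of_nonneg hr]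
        _ = ‖p • a + q • b‖ := by rw [hrc, norm_neg]
        _ ≤ ‖p • a‖ + ‖q • b‖ := norm_add_le _ _
        _ = p + q := by
          rw [norm_smul, norm_smul, ha, hb, Real.norm_of_nonneg hp, Real.norm_of_nonneg hq]; ring
    constructor
    · have : r * (1 + inner ℝ a b - inner ℝ b c - inner ℝ c a) =
          (1 + inner ℝ a b) * (p + q + r) := by linear_combination -h1 - h2
      refine nonneg_of_mul_nonneg_right ?_ hrpos
      rw [this, hsum]; linarith
    · have : r * (1 + inner ℝ a b + inner ℝ b c + inner ℝ c a) =
          (1 + inner ℝ a b) * (r - p - q) := by linear_combination h1 + h2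
      have hle : r * (1 + inner ℝ a b + inner ℝ b c + inner ℝ c a) ≤ 0 := by
        rw [this]; exact mul_nonpos_of_nonneg_of_nonpos (by linarith) (by linarith)
      by_contra hcon
      push Not at hcon
      exact absurd hle (not_le.2 (mul_pos hrpos hcon))

/-- The weight attached to the vertex `b` of the triangle `abc` vanishes when the edge from `a`
to `b` does, so that after weighting `⟪y, a⟫` and `-⟪y, b⟫` agree for every `y` for which `a - b`
is a multiple of `y`, the zero multiple included. The projection of `y' - y` on `b` then bounds
their sum. -/
lemma weighted_projection_le {a b c y y' : E} {ν D : ℝ} (ha : ‖a‖ = 1) (hb : ‖b‖ = 1)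
    (hE : a - b = ν • y) (hD : ‖y' - y‖ ≤ D)
    (hw : 0 ≤ 1 + inner ℝ c a - inner ℝ a b - inner ℝ b c) :
    (1 + inner ℝ c a - inner ℝ a b - inner ℝ b c) * (inner ℝ y a + inner ℝ y' b) ≤
      (1 + inner ℝ c a - inner ℝ a b - inner ℝ b c) * D := by
  have hproj : inner ℝ y' b - inner ℝ y b ≤ D := by
    rw [← inner_sub_left]
    calc inner ℝ (y' - y) b ≤ ‖y' - y‖ * ‖b‖ := real_inner_le_norm _ _
      _ ≤ D := by rw [hb, mul_one]; exact hD
  rcases eq_or_ne ν 0 with h0 | h0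
  · have hab : a = b := by rw [h0, zero_smul, sub_eq_zero] at hE; exact hE
    have : 1 + inner ℝ c a - inner ℝ a b - inner ℝ b c = 0 := by
      rw [hab, real_inner_comm b c, real_inner_self_eq_norm_sq, hb]; ring
    rw [this, zero_mul, zero_mul]
  · have key : inner ℝ y a + inner ℝ y b = 0 := by
      refine (mul_eq_zero.1 ?_).resolve_left h0
      rw [mul_add, ← real_inner_smul_left, ← real_inner_smul_left, ← hE, inner_sub_left,
        inner_sub_left, real_inner_self_eq_norm_sq, real_inner_self_eq_norm_sq, ha, hb,
        real_inner_comm a b]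
      ring
    exact mul_le_mul_of_nonneg_left (by linarith) hw

/-- A triangle inscribed in the unit circle and containing its centre has edges `νₖ yₖ` with
`∑ νₖ ≥ 8 / D` as soon as the points `yₖ` have mutual distances at most `D`. -/
lemma eight_le_of_triangle {a b c y₁ y₂ y₃ : E} {p q r ν₁ ν₂ ν₃ D : ℝ} (ha : ‖a‖ = 1)
    (hb : ‖b‖ = 1) (hc : ‖c‖ = 1) (hp : 0 ≤ p) (hq : 0 ≤ q) (hr : 0 ≤ r) (hsum : p + q + r = 1)
    (h0 : p • a + q • b + r • c = 0) (hν₁ : 0 ≤ ν₁) (hν₂ : 0 ≤ ν₂) (hν₃ : 0 ≤ ν₃)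
    (h₁ : a - b = ν₁ • y₁) (h₂ : b - c = ν₂ • y₂) (h₃ : c - a = ν₃ • y₃)
    (hD : 0 < D) (h₂₁ : ‖y₂ - y₁‖ ≤ D) (h₃₂ : ‖y₃ - y₂‖ ≤ D) (h₁₃ : ‖y₁ - y₃‖ ≤ D) :
    8 ≤ D * (ν₁ + ν₂ + ν₃) := by
  obtain ⟨hC, hS⟩ := inner_bounds_of_zero_mem_triangle ha hb hc hp hq hr hsum h0
  obtain ⟨hA, -⟩ := inner_bounds_of_zero_mem_triangle hb hc ha hq hr hp (by linarith)
    (by rw [← h0]; abel)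
  obtain ⟨hB, -⟩ := inner_bounds_of_zero_mem_triangle hc ha hb hr hp hq (by linarith)
    (by rw [← h0]; abel)
  have w₁ := weighted_projection_le ha hb h₁ h₂₁ hB
  have w₂ := weighted_projection_le hb hc h₂ h₃₂ hC
  have w₃ := weighted_projection_le hc ha h₃ h₁₃ hA
  have e₁ : ν₁ * inner ℝ y₁ a = 1 - inner ℝ a b := by
    rw [← real_inner_smul_left, ← h₁, inner_sub_left, real_inner_self_eq_norm_sq, ha,
      real_inner_comm a b]; ring
  have e₂ : ν₂ * inner ℝ y₂ b = 1 - inner ℝ b c := by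
    rw [← real_inner_smul_left, ← h₂, inner_sub_left, real_inner_self_eq_norm_sq, hb,
      real_inner_comm b c]; ring
  have e₃ : ν₃ * inner ℝ y₃ c = 1 - inner ℝ c a := by
    rw [← real_inner_smul_left, ← h₃, inner_sub_left, real_inner_self_eq_norm_sq, hc,
      real_inner_comm c a]; ring
  generalize inner ℝ a b = x at *
  generalize inner ℝ b c = y at *
  generalize inner ℝ c a = w at *
  generalize inner ℝ y₁ a = r₁ at *
  generalize inner ℝ y₂ b = r₂ at *
  generalize inner ℝ y₃ c = r₃ at *
  -- Tangent-line form of the Cauchy-Schwarz inequality, at the extremal value `rₖ = D / 2`.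
  have s₁ := mul_nonneg hν₁ (sq_nonneg (r₁ - D / 2))
  have s₂ := mul_nonneg hν₂ (sq_nonneg (r₂ - D / 2))
  have s₃ := mul_nonneg hν₃ (sq_nonneg (r₃ - D / 2))
  have f₁ : ν₁ * (r₁ - D / 2) ^ 2 = (1 - x) * (r₁ - D) + D ^ 2 / 4 * ν₁ := by
    linear_combination (r₁ - D) * e₁
  have f₂ : ν₂ * (r₂ - D / 2) ^ 2 = (1 - y) * (r₂ - D) + D ^ 2 / 4 * ν₂ := by
    linear_combination (r₂ - D) * e₂
  have f₃ : ν₃ * (r₃ - D / 2) ^ 2 = (1 - w) * (r₃ - D) + D ^ 2 / 4 * ν₃ := by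
    linear_combination (r₃ - D) * e₃
  have hfin : D * (3 - x - y - w) / 2 ≤ D ^ 2 / 4 * (ν₁ + ν₂ + ν₃) := by linarith
  have hmul : D * 8 ≤ D * (D * (ν₁ + ν₂ + ν₃)) := by nlinarith
  exact le_of_mul_le_mul_left hmul hD

end Triangle

/-! ### Merging consecutive edges of a closed polygon -/

section Polygon

variable {E : Type*} [NormedAddCommGroup E] [InnerProductSpace ℝ E]

/-- A sum of nonnegative multiples of points of a convex set is a multiple of one point of it. -/
lemma exists_mem_sum_smul_eq {ι : Type*} {M : Set E} (hM : Convex ℝ M) (hne : M.Nonempty)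
    (S : Finset ι) (ν : ι → ℝ) (x : ι → E) (hν : ∀ i, 0 ≤ ν i) (hx : ∀ i, x i ∈ M) :
    ∃ y ∈ M, ∑ i ∈ S, ν i • x i = (∑ i ∈ S, ν i) • y := by
  rcases (Finset.sum_nonneg fun i (_ : i ∈ S) => hν i).eq_or_lt with h | h
  · obtain ⟨y, hy⟩ := hne
    refine ⟨y, hy, ?_⟩
    rw [← h, zero_smul]
    refine Finset.sum_eq_zero fun i hi => ?_
    rw [(Finset.sum_eq_zero_iff_of_nonneg fun i _ => hν i).1 h.symm i hi, zero_smul]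
  · refine ⟨S.centerMass ν x, hM.centerMass_mem (fun i _ => hν i) h fun i _ => hx i, ?_⟩
    rw [Finset.centerMass, smul_smul, mul_inv_cancel₀ h.ne', one_smul]

lemma sum_Ioc_zero_sub {G : Type*} [AddCommGroup G] {m : ℕ} (d : Fin (m + 1) → G)
    (k : Fin (m + 1)) :
    ∑ i ∈ Finset.Ioc 0 k, (d (i - 1) - d i) = d 0 - d k := by
  induction k using Fin.induction with
  | zero => simp
  | succ k ih =>
    have hI : Finset.Ioc 0 k.succ = insert k.succ (Finset.Ioc 0 k.castSucc) := by
      ext i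
      simp only [Finset.mem_Ioc, Finset.mem_insert, Fin.lt_def, Fin.le_def, Fin.ext_iff,
        Fin.val_succ, Fin.val_castSucc, Fin.val_zero]
      omega
    have hk : k.succ - 1 = k.castSucc := by
      rw [sub_eq_iff_eq_add, Fin.coeSucc_eq_succ]
    rw [hI, Finset.sum_insert (by simp), ih, hk]
    abel

lemma sum_Ioc_sub {G : Type*} [AddCommGroup G] {m : ℕ} (d : Fin (m + 1) → G)
    {k l : Fin (m + 1)} (h : k ≤ l) :
    ∑ i ∈ Finset.Ioc k l, (d (i - 1) - d i) = d k - d l := by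
  have hU : Finset.Ioc 0 l = Finset.Ioc 0 k ∪ Finset.Ioc k l := by
    rw [Finset.Ioc_union_Ioc_eq_Ioc (Fin.zero_le _) h]
  have hd : Disjoint (Finset.Ioc 0 k) (Finset.Ioc k l) := by
    rw [Finset.disjoint_left]
    intro i hi hi'
    exact absurd (Finset.mem_Ioc.1 hi).2 (not_le.2 (Finset.mem_Ioc.1 hi').1)
  have := sum_Ioc_zero_sub d l
  rw [hU, Finset.sum_union hd, sum_Ioc_zero_sub] at this
  rw [← sub_eq_zero] at this ⊢
  rw [← this]; abel

lemma sum_cyclic_sub {G : Type*} [AddCommGroup G] {m : ℕ} (d : Fin (m + 1) → G) :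
    ∑ i, (d (i - 1) - d i) = 0 := by
  rw [Finset.sum_sub_distrib, sub_eq_zero]
  exact (Equiv.subRight (1 : Fin (m + 1))).sum_comp d

/-- In a plane, three points suffice in Carathéodory's theorem; the points may coincide. -/
lemma exists_three_of_mem_convexHull_range {ι : Type*} (hdim : Module.finrank ℝ E = 2)
    {d : ι → E} {x : E} (hx : x ∈ convexHull ℝ (Set.range d)) :
    ∃ (f : Fin 3 → ι) (p : Fin 3 → ℝ), (∀ j, 0 ≤ p j) ∧ ∑ j, p j = 1 ∧
      ∑ j, p j • d (f j) = x := by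
  have : FiniteDimensional ℝ E := Module.finite_of_finrank_eq_succ hdim
  obtain ⟨κ, _, z, w, hz, hind, hw, hw1, hwx⟩ := eq_pos_convex_span_of_mem_convexHull hx
  have hcard : Fintype.card κ ≤ 3 := by
    have h1 := hind.card_le_finrank_succ
    have h2 := Submodule.finrank_le (vectorSpan ℝ (Set.range z))
    omega
  have hκ : Nonempty κ := by
    by_contra h
    rw [not_nonempty_iff] at h
    simp at hw1
  choose g hg using fun i => hz (Set.mem_range_self i)
  obtain ⟨e⟩ : Nonempty (κ ↪ Fin 3) :=
    Function.Embedding.nonempty_of_card_le (by simpa using hcard)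
  -- Indices outside the range of `e` get weight zero.
  classical
  refine ⟨fun j => g (Function.invFun e j), fun j => ∑ i, if e i = j then w i else 0,
    fun j => Finset.sum_nonneg fun i _ => by split_ifs; exacts [(hw i).le, le_rfl], ?_, ?_⟩
  · rw [Finset.sum_comm]; simpa using hw1
  · simp_rw [Finset.sum_smul]
    rw [Finset.sum_comm, ← hwx]
    refine Finset.sum_congr rfl fun i _ => ?_
    simp [ite_smul, Function.leftInverse_invFun e.injective i, hg]

/-- Let unit vectors `dᵢ` in a plane have `0` in their convex hull, and let the edges of the closed
polygon they span be `νᵢ xᵢ` with `νᵢ ≥ 0` and `xᵢ` in a convex set of diameter at most `D`.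
Then `∑ νᵢ ≥ 8 / D`. -/
lemma eight_le_of_polygon (hdim : Module.finrank ℝ E = 2) {M : Set E} (hM : Convex ℝ M)
    (hne : M.Nonempty) {D : ℝ} (hD : 0 < D) (hdiam : ∀ x ∈ M, ∀ y ∈ M, ‖x - y‖ ≤ D) {m : ℕ}
    {d x : Fin (m + 1) → E} {ν : Fin (m + 1) → ℝ} (hd : ∀ i, ‖d i‖ = 1)
    (h0 : (0 : E) ∈ convexHull ℝ (Set.range d)) (hν : ∀ i, 0 ≤ ν i) (hx : ∀ i, x i ∈ M)
    (hedge : ∀ i, d (i - 1) - d i = ν i • x i) :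
    8 ≤ D * ∑ i, ν i := by
  obtain ⟨f, p, hp, hp1, hp0⟩ := exists_three_of_mem_convexHull_range hdim h0
  set σ := Tuple.sort f
  have hmono := Tuple.monotone_sort f
  have h01 : f (σ 0) ≤ f (σ 1) := hmono (by decide)
  have h12 : f (σ 1) ≤ f (σ 2) := hmono (by decide)
  rw [← Equiv.sum_comp σ, Fin.sum_univ_three] at hp1 hp0
  set S₁ := Finset.Ioc (f (σ 0)) (f (σ 1))
  set S₂ := Finset.Ioc (f (σ 1)) (f (σ 2))
  set S := Finset.Ioc (f (σ 0)) (f (σ 2))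
  have hU : S = S₁ ∪ S₂ := (Finset.Ioc_union_Ioc_eq_Ioc h01 h12).symm
  have hdisj : Disjoint S₁ S₂ := by
    rw [Finset.disjoint_left]
    intro i hi hi'
    exact absurd (Finset.mem_Ioc.1 hi).2 (not_le.2 (Finset.mem_Ioc.1 hi').1)
  obtain ⟨y₁, hy₁, e₁⟩ := exists_mem_sum_smul_eq hM hne S₁ ν x hν hx
  obtain ⟨y₂, hy₂, e₂⟩ := exists_mem_sum_smul_eq hM hne S₂ ν x hν hx
  obtain ⟨y₃, hy₃, e₃⟩ := exists_mem_sum_smul_eq hM hne Sᶜ ν x hν hx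
  have t₁ := sum_Ioc_sub d h01
  have t₂ := sum_Ioc_sub d h12
  -- The edge from the last chosen vertex back to the first one wraps around the index `0`.
  have t₃ : ∑ i ∈ Sᶜ, (d (i - 1) - d i) = d (f (σ 2)) - d (f (σ 0)) := by
    have h := Finset.sum_add_sum_compl S fun i => d (i - 1) - d i
    rw [sum_cyclic_sub, sum_Ioc_sub d (h01.trans h12)] at h
    rw [eq_neg_of_add_eq_zero_right h, neg_sub]
  simp_rw [hedge] at t₁ t₂ t₃
  have hsum : ∑ i, ν i = ∑ i ∈ S₁, ν i + ∑ i ∈ S₂, ν i + ∑ i ∈ Sᶜ, ν i := by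
    rw [← Finset.sum_union hdisj, ← hU, Finset.sum_add_sum_compl]
  rw [hsum]
  exact eight_le_of_triangle (hd _) (hd _) (hd _) (hp _) (hp _) (hp _) hp1 hp0
    (Finset.sum_nonneg fun i _ => hν i) (Finset.sum_nonneg fun i _ => hν i)
    (Finset.sum_nonneg fun i _ => hν i) (t₁.symm.trans e₁) (t₂.symm.trans e₂)
    (t₃.symm.trans e₃) hD (hdiam _ hy₂ _ hy₁) (hdiam _ hy₃ _ hy₂) (hdiam _ hy₁ _ hy₃)

end Polygon

/-! ### Outer normals of a polar set -/

section Polar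

variable {E : Type*} [NormedAddCommGroup E] [InnerProductSpace ℝ E]

lemma convex_polarAbout (K : Set E) (z : E) : Convex ℝ (polarAbout K z) := by
  intro y hy y' hy' s t hs ht hst x hx
  have h1 := mul_le_mul_of_nonneg_left (hy x hx) hs
  have h2 := mul_le_mul_of_nonneg_left (hy' x hx) ht
  rw [inner_add_right, real_inner_smul_right, real_inner_smul_right]
  linarith

/-- The cone over a compact convex set `M`, truncated at height `c`, is convex. -/
lemma convex_image_smul {M : Set E} (hM : Convex ℝ M) (c : ℝ) :
    Convex ℝ ((fun v : ℝ × E => v.1 • v.2) '' Set.Icc 0 c ×ˢ M) := by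
  rintro _ ⟨⟨t, x⟩, ⟨ht, hx⟩, rfl⟩ _ ⟨⟨t', x'⟩, ⟨ht', hx'⟩, rfl⟩ a b ha hb hab
  have hν : ∀ i, 0 ≤ ![a * t, b * t'] i := by
    simpa [Fin.forall_fin_two] using ⟨mul_nonneg ha ht.1, mul_nonneg hb ht'.1⟩
  obtain ⟨y, hy, e⟩ := exists_mem_sum_smul_eq hM ⟨x, hx⟩ Finset.univ ![a * t, b * t'] ![x, x']
    hν (by simpa [Fin.forall_fin_two] using ⟨hx, hx'⟩)
  refine ⟨(a * t + b * t', y), ⟨?_, hy⟩, ?_⟩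
  · exact convex_Icc 0 c ht ht' ha hb hab
  · simpa [smul_smul] using e.symm

/-- A bipolar theorem for possibly unbounded polars: the base point `z` may lie outside `K`. Since
`K` is bounded, its polar is a neighbourhood of `0`, and an outer normal `n` of the polar at `q` is
a multiple `t (x - z)` of a point of `K - z`; the multiple is at most the support value `⟪n, q⟫`. -/
lemma exists_eq_smul_of_outer_normal_polarAbout [CompleteSpace E] {K : Set E} (hK : Convex ℝ K)
    (hc : IsCompact K) (hne : K.Nonempty) {z n q : E} (hn : n ≠ 0)
    (hmax : ∀ y ∈ polarAbout K z, inner ℝ n y ≤ inner ℝ n q) :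
    ∃ t : ℝ, ∃ x ∈ (fun x => x - z) '' K, 0 ≤ t ∧ t ≤ inner ℝ n q ∧ n = t • x := by
  set M := (fun x => x - z) '' K
  have hMc : IsCompact M := hc.image (by fun_prop)
  have hM : Convex ℝ M := by
    have := hK.translate (-z)
    simpa [M, neg_add_eq_sub] using this
  set c := inner ℝ n q
  have hcpos : 0 < c := by
    obtain ⟨R, hR, hKR⟩ := hMc.isBounded.exists_pos_norm_le
    have hn' : 0 < ‖n‖ := norm_pos_iff.2 hn
    have hy : (R * ‖n‖)⁻¹ • n ∈ polarAbout K z := by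
      intro x hx
      have h1 := (real_inner_le_norm (x - z) n).trans
        (mul_le_mul_of_nonneg_right (hKR _ ⟨x, hx, rfl⟩) hn'.le)
      rw [real_inner_smul_right, inv_mul_le_iff₀ (by positivity), mul_one]
      exact h1
    refine lt_of_lt_of_le ?_ (hmax _ hy)
    rw [real_inner_smul_right, real_inner_self_eq_norm_sq]
    positivity
  set N := (fun v : ℝ × E => v.1 • v.2) '' Set.Icc 0 c ×ˢ M
  have hNc : IsCompact N := (isCompact_Icc.prod hMc).image (by fun_prop)
  have hN : Convex ℝ N := convex_image_smul hM c
  by_cases hmem : n ∈ N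
  · obtain ⟨⟨t, x⟩, ⟨ht, hx⟩, rfl⟩ := hmem
    exact ⟨t, x, hx, ht.1, ht.2, rfl⟩
  exfalso
  obtain ⟨f, u, hfu, hun⟩ := geometric_hahn_banach_closed_point hN hNc.isClosed hmem
  obtain ⟨x₀, hx₀⟩ := hne
  have hu : 0 < u := by
    have := hfu 0 ⟨(0, x₀ - z), ⟨⟨le_rfl, hcpos.le⟩, ⟨x₀, hx₀, rfl⟩⟩, by simp⟩
    simpa using this
  set w := (InnerProductSpace.toDual ℝ E).symm f
  have hw : ∀ v, f v = inner ℝ w v := fun v => by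
    simp [w, InnerProductSpace.toDual_symm_apply]
  -- The separating functional, rescaled, is a point of the polar beyond the supporting line.
  have hy : (c / u) • w ∈ polarAbout K z := by
    intro x hx
    have := hfu (c • (x - z)) ⟨(c, x - z), ⟨⟨hcpos.le, le_rfl⟩, ⟨x, hx, rfl⟩⟩, rfl⟩
    rw [hw, real_inner_smul_right] at this
    rw [real_inner_smul_right, real_inner_comm, div_mul_eq_mul_div, div_le_one hu]
    exact this.le
  have h := hmax _ hy
  rw [real_inner_smul_right, real_inner_comm, ← hw, div_mul_eq_mul_div, div_le_iff₀ hu] at h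
  exact absurd hun (not_lt.2 (le_of_mul_le_mul_left h hcpos))

/-- A point of a set at which a nonzero linear functional attains its maximum over the set is a
boundary point. -/
lemma mem_frontier_of_inner_le {C : Set E} {q n : E} (hq : q ∈ C) (hn : n ≠ 0)
    (hmax : ∀ y ∈ C, inner ℝ n y ≤ inner ℝ n q) : q ∈ frontier C := by
  refine ⟨subset_closure hq, fun hint => ?_⟩
  have hmem : C ∈ nhds (q + (0 : ℝ) • n) := by
    rw [zero_smul, add_zero]; exact mem_interior_iff_mem_nhds.1 hint
  have hcont : Continuous fun t : ℝ => q + t • n := by fun_prop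
  have hev := hcont.continuousAt.eventually_mem hmem
  obtain ⟨t, ht, ht0⟩ :=
    ((hev.filter_mono nhdsWithin_le_nhds).and (self_mem_nhdsWithin (s := Set.Ioi (0 : ℝ)))).exists
  have h := hmax _ ht
  rw [inner_add_right, real_inner_smul_right] at h
  have : 0 < t * inner ℝ n n := mul_pos ht0 (real_inner_self_pos.2 hn)
  linarith

end Polar

/-! ### Closed polygonal curves and the lower bound -/

section LowerBound

variable {E : Type*} [NormedAddCommGroup E] [InnerProductSpace ℝ E]

lemma norm_edgeDir {m : ℕ} {q : Fin (m + 1) → E} {i : Fin (m + 1)} (h : q i ≠ q (i + 1)) :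
    ‖edgeDir q i‖ = 1 := by
  have : ‖q (i + 1) - q i‖ ≠ 0 := norm_ne_zero_iff.2 (sub_ne_zero.2 h.symm)
  rw [edgeDir, norm_smul, norm_inv, norm_norm, inv_mul_cancel₀ this]

lemma norm_smul_edgeDir {m : ℕ} {q : Fin (m + 1) → E} {i : Fin (m + 1)} (h : q i ≠ q (i + 1)) :
    ‖q (i + 1) - q i‖ • edgeDir q i = q (i + 1) - q i := by
  have : ‖q (i + 1) - q i‖ ≠ 0 := norm_ne_zero_iff.2 (sub_ne_zero.2 h.symm)
  rw [edgeDir, smul_smul, mul_inv_cancel₀ this, one_smul]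

lemma zero_mem_convexHull_edgeDir {m : ℕ} {q : Fin (m + 1) → E} (h : ∀ i, q i ≠ q (i + 1)) :
    (0 : E) ∈ convexHull ℝ (Set.range (edgeDir q)) := by
  have hpos : ∀ i, 0 < ‖q (i + 1) - q i‖ := fun i => norm_pos_iff.2 (sub_ne_zero.2 (h i).symm)
  have hsum : ∑ i, ‖q (i + 1) - q i‖ • edgeDir q i = 0 := by
    simp_rw [norm_smul_edgeDir (h _)]
    rw [Finset.sum_sub_distrib, sub_eq_zero]
    exact Equiv.sum_comp (Equiv.addRight (1 : Fin (m + 1))) q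
  have := Finset.univ.centerMass_mem_convexHull (w := fun i => ‖q (i + 1) - q i‖)
    (z := edgeDir q) (s := Set.range (edgeDir q)) (fun i _ => (hpos i).le)
    (Finset.sum_pos (fun i _ => hpos i) Finset.univ_nonempty) fun i _ => Set.mem_range_self i
  rwa [Finset.centerMass, hsum, smul_zero] at this

/-- Summation by parts: the length of a closed polygonal curve in terms of the changes of its
direction. -/
lemma closedLength_eq_sum_inner {m : ℕ} {q : Fin (m + 1) → E} (h : ∀ i, q i ≠ q (i + 1)) :
    closedLength q = ∑ i, inner ℝ (q i) (edgeDir q (i - 1) - edgeDir q i) := by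
  have hlen : ∀ i, dist (q i) (q (i + 1)) =
      inner ℝ (q (i + 1)) (edgeDir q i) - inner ℝ (q i) (edgeDir q i) := by
    intro i
    rw [← inner_sub_left, ← norm_smul_edgeDir (h i), real_inner_smul_left,
      real_inner_self_eq_norm_sq, norm_edgeDir (h i), dist_comm, dist_eq_norm]
    ring
  have hshift := Equiv.sum_comp (Equiv.addRight (1 : Fin (m + 1)))
    fun i => inner ℝ (q i) (edgeDir q (i - 1))
  simp only [Equiv.coe_addRight, add_sub_cancel_right] at hshift
  simp_rw [closedLength, hlen, inner_sub_right]
  rw [Finset.sum_sub_distrib, Finset.sum_sub_distrib, hshift]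

/-- The change of direction at a vertex of a billiard trajectory of a polar is a nonnegative
multiple of a point of `K - z`, with a multiple bounded by the contribution of the vertex to
the length. -/
lemma IsClosedBilliardTrajectory.exists_edgeDir_sub_eq_smul [CompleteSpace E] {K : Set E}
    (hK : Convex ℝ K) (hc : IsCompact K) (hne : K.Nonempty) {z : E} {m : ℕ}
    {q : Fin (m + 1) → E} (hq : IsClosedBilliardTrajectory (polarAbout K z) q)
    (i : Fin (m + 1)) :
    ∃ ν : ℝ, ∃ x ∈ (fun x => x - z) '' K, 0 ≤ ν ∧
      ν ≤ inner ℝ (q i) (edgeDir q (i - 1) - edgeDir q i) ∧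
      edgeDir q (i - 1) - edgeDir q i = ν • x := by
  by_cases heq : edgeDir q (i - 1) = edgeDir q i
  · obtain ⟨x, hx⟩ := hne
    exact ⟨0, x - z, ⟨x, hx, rfl⟩, le_rfl, by simp [heq], by simp [heq]⟩
  obtain ⟨-, n, ⟨-, hn1, hmax⟩, hrefl⟩ := hq.reflect i heq
  have hn : n ≠ 0 := fun h => by simp [h] at hn1
  obtain ⟨t, x, hx, ht0, ht, hnx⟩ :=
    exists_eq_smul_of_outer_normal_polarAbout hK hc hne hn hmax
  have hdiff : edgeDir q (i - 1) - edgeDir q i = (2 * inner ℝ n (edgeDir q (i - 1))) • n := by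
    rw [hrefl]; abel
  -- The trajectory arrives at `q i` from inside the supporting half-plane.
  have hlam : 0 ≤ inner ℝ n (edgeDir q (i - 1)) := by
    have hprev := hmax _ (hq.segment_subset (i - 1) (left_mem_segment ℝ _ _))
    rw [edgeDir, sub_add_cancel, real_inner_smul_right, inner_sub_right]
    exact mul_nonneg (by positivity) (by linarith)
  refine ⟨2 * inner ℝ n (edgeDir q (i - 1)) * t, x, hx, by positivity, ?_, ?_⟩
  · rw [hdiff, real_inner_smul_right, real_inner_comm n (q i)]
    exact mul_le_mul_of_nonneg_left ht (mul_nonneg two_pos.le hlam)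
  · rw [hdiff, mul_smul _ t x, ← hnx]

theorem IsClosedBilliardTrajectory.eight_le_diam_mul_closedLength
    (hdim : Module.finrank ℝ E = 2) {K : Set E} (hK : Convex ℝ K) (hc : IsCompact K)
    (hdiam : 0 < Metric.diam K) {z : E} {m : ℕ} {q : Fin (m + 1) → E}
    (hq : IsClosedBilliardTrajectory (polarAbout K z) q) :
    8 ≤ Metric.diam K * closedLength q := by
  have : FiniteDimensional ℝ E := Module.finite_of_finrank_eq_succ hdim
  have : CompleteSpace E := FiniteDimensional.complete ℝ E
  have hne : K.Nonempty := by
    rw [Set.nonempty_iff_ne_empty]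
    rintro rfl
    simp at hdiam
  choose ν x hx hν hle hedge using
    fun i => hq.exists_edgeDir_sub_eq_smul hK hc hne i
  have hM : Convex ℝ ((fun x => x - z) '' K) := by
    have := hK.translate (-z)
    simpa [neg_add_eq_sub] using this
  have h8 := eight_le_of_polygon hdim hM (hne.image _) hdiam
    (by
      rintro _ ⟨a, ha, rfl⟩ _ ⟨b, hb, rfl⟩
      rw [sub_sub_sub_cancel_right, ← dist_eq_norm]
      exact Metric.dist_le_diam_of_mem hc.isBounded ha hb)
    (fun i => norm_edgeDir (hq.ne_succ i)) (zero_mem_convexHull_edgeDir hq.ne_succ) hν hx hedge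
  refine h8.trans (mul_le_mul_of_nonneg_left ?_ hdiam.le)
  rw [closedLength_eq_sum_inner hq.ne_succ]
  exact Finset.sum_le_sum fun i _ => hle i

theorem eight_div_diam_le_shortestBilliard (hdim : Module.finrank ℝ E = 2) {K : Set E}
    (hK : Convex ℝ K) (hc : IsCompact K) (hdiam : 0 < Metric.diam K) (z : E) :
    8 / ENNReal.ofReal (Metric.diam K) ≤ shortestBilliard (polarAbout K z) := by
  refine le_iInf fun m => le_iInf fun q => le_iInf fun hq => ?_
  have h := hq.eight_le_diam_mul_closedLength hdim hK hc hdiam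
  have h8 : (8 : ℝ≥0∞) = ENNReal.ofReal 8 := by simp
  rw [h8, ← ENNReal.ofReal_div_of_pos hdiam]
  exact ENNReal.ofReal_le_ofReal ((div_le_iff₀' hdiam).2 h)

end LowerBound

/-! ### The double segment along a diameter -/

section Diameter

variable {E : Type*} [NormedAddCommGroup E] [InnerProductSpace ℝ E]

/-- `K` lies in the strip bounded by the normals to a diameter at its endpoints. -/
lemma inner_sub_midpoint_le {K : Set E} (hb : Bornology.IsBounded K) {a b x : E} (hbK : b ∈ K)
    (hab : dist a b = Metric.diam K) (hx : x ∈ K) :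
    inner ℝ (x - midpoint ℝ a b) (a - b) ≤ Metric.diam K ^ 2 / 2 := by
  have h1 : inner ℝ (x - b) (a - b) ≤ Metric.diam K ^ 2 := by
    refine (real_inner_le_norm _ _).trans ?_
    rw [← dist_eq_norm a b, hab, ← dist_eq_norm, sq]
    exact mul_le_mul_of_nonneg_right (Metric.dist_le_diam_of_mem hb hx hbK) Metric.diam_nonneg
  have h2 : x - midpoint ℝ a b = (x - b) - (1 / 2 : ℝ) • (a - b) := by
    rw [midpoint_eq_smul_add, invOf_eq_inv]; module
  rw [h2, inner_sub_left, real_inner_smul_left, real_inner_self_eq_norm_sq, ← dist_eq_norm a b,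
    hab]
  linarith

/-- The polar about the midpoint of a diameter has a billiard trajectory that runs twice through a
segment parallel to the diameter. -/
lemma exists_trajectory_of_diameter {K : Set E} (hc : IsCompact K) (hdiam : 0 < Metric.diam K)
    {a b : E} (ha : a ∈ K) (hb : b ∈ K) (hab : dist a b = Metric.diam K) :
    ∃ q : Fin (1 + 1) → E, IsClosedBilliardTrajectory (polarAbout K (midpoint ℝ a b)) q ∧
      closedLength q = 8 / Metric.diam K := by
  set D := Metric.diam K
  set z := midpoint ℝ a b
  set C := polarAbout K z
  set u := D⁻¹ • (a - b)
  have hu : ‖u‖ = 1 := by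
    rw [norm_smul, ← dist_eq_norm, hab, norm_inv, Real.norm_of_nonneg hdiam.le,
      inv_mul_cancel₀ hdiam.ne']
  have hu0 : u ≠ 0 := fun h => by simp [h] at hu
  have huu : inner ℝ u u = 1 := by rw [real_inner_self_eq_norm_sq, hu, one_pow]
  have haz : a - z = (D / 2) • u := by
    simp only [u, z, midpoint_eq_smul_add, invOf_eq_inv, smul_smul]
    rw [show D / 2 * D⁻¹ = 1 / 2 by field_simp]; module
  have hbz : b - z = -((D / 2) • u) := by
    simp only [u, z, midpoint_eq_smul_add, invOf_eq_inv, smul_smul]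
    rw [show D / 2 * D⁻¹ = 1 / 2 by field_simp]; module
  have hstrip : ∀ x ∈ K, |inner ℝ (x - z) u| ≤ D / 2 := by
    intro x hx
    have h1 := inner_sub_midpoint_le hc.isBounded hb hab hx
    have h2 := inner_sub_midpoint_le hc.isBounded ha ((dist_comm b a).trans hab) hx
    rw [midpoint_comm (R := ℝ) b a, ← neg_sub a b, inner_neg_right] at h2
    rw [real_inner_smul_right, abs_mul, abs_inv, abs_of_pos hdiam, inv_mul_le_iff₀ hdiam, abs_le]
    constructor <;> nlinarith
  have hCu : ∀ y ∈ C, |inner ℝ u y| ≤ 2 / D := by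
    intro y hy
    have h1 := hy a ha
    have h2 := hy b hb
    rw [haz, real_inner_smul_left] at h1
    rw [hbz, inner_neg_left, real_inner_smul_left] at h2
    rw [le_div_iff₀ hdiam, ← abs_of_pos hdiam, ← abs_mul, abs_le]
    constructor <;> linarith
  have hmem : ∀ s : ℝ, |s| ≤ 2 / D → s • u ∈ C := by
    intro s hs x hx
    rw [real_inner_smul_right]
    calc s * inner ℝ (x - z) u ≤ |s| * |inner ℝ (x - z) u| := by
          rw [← abs_mul]; exact le_abs_self _
      _ ≤ 2 / D * (D / 2) := mul_le_mul hs (hstrip x hx) (abs_nonneg _) (by positivity)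
      _ = 1 := by field_simp
  set r := 2 / D
  have hr : 0 < r := by positivity
  have hr1 : r • u ∈ C := hmem r (abs_of_pos hr).le
  have hr2 : (-r) • u ∈ C := hmem (-r) (by rw [abs_neg, abs_of_pos hr])
  have hn1 : IsOuterUnitNormal C (r • u) u := by
    refine ⟨hr1, hu, fun y hy => ?_⟩
    rw [real_inner_smul_right, huu, mul_one]
    exact (le_abs_self _).trans (hCu y hy)
  have hn2 : IsOuterUnitNormal C ((-r) • u) (-u) := by
    refine ⟨hr2, by rw [norm_neg, hu], fun y hy => ?_⟩
    rw [inner_neg_left, inner_neg_left, real_inner_smul_right, huu]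
    have := (neg_le_abs _).trans (hCu y hy)
    linarith
  have hdist : ‖r • u - (-r) • u‖ = 2 * r := by
    rw [← sub_smul, norm_smul, hu, Real.norm_of_nonneg (by linarith)]; ring
  have hne : r • u ≠ (-r) • u := by
    rw [← sub_ne_zero, ← norm_ne_zero_iff, hdist]; positivity
  set q : Fin (1 + 1) → E := ![r • u, (-r) • u] with hqdef
  have hq0 : q 0 = r • u := rfl
  have hq1 : q 1 = (-r) • u := rfl
  have i00 : (0 : Fin (1 + 1)) + 1 = 1 := rfl
  have i11 : (1 : Fin (1 + 1)) + 1 = 0 := rfl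
  have i01 : (0 : Fin (1 + 1)) - 1 = 1 := rfl
  have i10 : (1 : Fin (1 + 1)) - 1 = 0 := rfl
  have hd1 : edgeDir q 1 = u := by
    rw [edgeDir, i11, hq0, hq1, hdist, ← sub_smul, smul_smul,
      show (2 * r)⁻¹ * (r - -r) = 1 by field_simp; ring, one_smul]
  have hd0 : edgeDir q 0 = -u := by
    rw [edgeDir, i00, hq0, hq1, norm_sub_rev, hdist, ← sub_smul, smul_smul,
      show (2 * r)⁻¹ * (-r - r) = -1 by field_simp; ring, neg_one_smul]
  refine ⟨q, ⟨?_, ?_, ?_⟩, ?_⟩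
  · rw [Fin.forall_fin_two, i00, i11]
    exact ⟨hne, hne.symm⟩
  · rw [Fin.forall_fin_two, i00, i11]
    have hC := convex_polarAbout K z
    exact ⟨hC.segment_subset hr1 hr2, hC.segment_subset hr2 hr1⟩
  · rw [Fin.forall_fin_two, i01, i10, hd0, hd1]
    refine ⟨fun _ => ⟨mem_frontier_of_inner_le hr1 hu0 hn1.2.2, u, hn1, ?_⟩,
      fun _ => ⟨mem_frontier_of_inner_le hr2 (neg_ne_zero.2 hu0) hn2.2.2, -u, hn2, ?_⟩⟩
    · rw [huu]; module
    · rw [inner_neg_neg, huu]; module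
  · rw [closedLength, Fin.sum_univ_two, i00, i11, dist_comm (q 1), hq0, hq1, dist_eq_norm, hdist]
    ring

theorem shortestBilliard_polarAbout_midpoint (hdim : Module.finrank ℝ E = 2) {K : Set E}
    (hK : Convex ℝ K) (hc : IsCompact K) (hdiam : 0 < Metric.diam K) {a b : E} (ha : a ∈ K)
    (hb : b ∈ K) (hab : dist a b = Metric.diam K) :
    shortestBilliard (polarAbout K (midpoint ℝ a b)) = 8 / ENNReal.ofReal (Metric.diam K) := by
  refine le_antisymm ?_ (eight_div_diam_le_shortestBilliard hdim hK hc hdiam _)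
  obtain ⟨q, hq, hlen⟩ := exists_trajectory_of_diameter hc hdiam ha hb hab
  refine (iInf₂_le_of_le 1 q <| iInf_le _ hq).trans_eq ?_
  rw [hlen, ENNReal.ofReal_div_of_pos hdiam]
  simp

lemma exists_dist_eq_diam {X : Type*} [PseudoMetricSpace X] {K : Set X} (hc : IsCompact K)
    (hne : K.Nonempty) : ∃ a ∈ K, ∃ b ∈ K, dist a b = Metric.diam K := by
  obtain ⟨⟨a, b⟩, ⟨ha, hb⟩, hmax⟩ := (hc.prod hc).exists_isMaxOn (hne.prod hne)
    (continuous_dist (α := X)).continuousOn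
  refine ⟨a, ha, b, hb, le_antisymm (Metric.dist_le_diam_of_mem hc.isBounded ha hb) ?_⟩
  exact Metric.diam_le_of_forall_dist_le dist_nonneg fun x hx y hy =>
    hmax (Set.mk_mem_prod hx hy)

end Diameter

end BilliardPolar

/-! ### The infimum over all base points and the billiard product -/

theorem theorem1 (K : Set (EuclideanSpace ℝ (Fin 2))) (hconv : Convex ℝ K) (hcomp : IsCompact K)
    (hint : (interior K).Nonempty) :
    (⨅ z : EuclideanSpace ℝ (Fin 2),
        BilliardPolar.shortestBilliard (BilliardPolar.polarAbout K z)) =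
      8 / ENNReal.ofReal (Metric.diam K) ∧
    (∀ a ∈ K, ∀ b ∈ K, dist a b = Metric.diam K →
      BilliardPolar.shortestBilliard (BilliardPolar.polarAbout K (midpoint ℝ a b)) =
        ⨅ z : EuclideanSpace ℝ (Fin 2),
          BilliardPolar.shortestBilliard (BilliardPolar.polarAbout K z)) ∧
    BilliardPolar.billiardProduct K =
      8 * BilliardPolar.shortestBilliard K / ENNReal.ofReal (Metric.diam K) := by
  have hdim : Module.finrank ℝ (EuclideanSpace ℝ (Fin 2)) = 2 := finrank_euclideanSpace_fin
  have hne : K.Nonempty := hint.mono interior_subset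
  have hdiam : 0 < Metric.diam K := by
    refine Metric.diam_pos ?_ hcomp.isBounded
    rw [← Set.not_subsingleton_iff]
    intro hs
    obtain ⟨x, hx⟩ := hint
    have hpre := hs.anti (interior_subset (s := K))
    have hx' : interior K = {x} := hpre.eq_singleton_of_mem hx
    exact not_isOpen_singleton x (hx' ▸ isOpen_interior)
  have hlow := BilliardPolar.eight_div_diam_le_shortestBilliard hdim hconv hcomp hdiam
  obtain ⟨a, ha, b, hb, hab⟩ := BilliardPolar.exists_dist_eq_diam hcomp hne
  have hmid := BilliardPolar.shortestBilliard_polarAbout_midpoint hdim hconv hcomp hdiam ha hb hab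
  have hinf : (⨅ z : EuclideanSpace ℝ (Fin 2),
      BilliardPolar.shortestBilliard (BilliardPolar.polarAbout K z)) =
      8 / ENNReal.ofReal (Metric.diam K) :=
    le_antisymm ((iInf_le _ (midpoint ℝ a b)).trans_eq hmid) (le_iInf hlow)
  refine ⟨hinf, fun a' ha' b' hb' hab' => ?_, ?_⟩
  · rw [hinf, BilliardPolar.shortestBilliard_polarAbout_midpoint hdim hconv hcomp hdiam ha' hb'
      hab']
  · -- The infimum is attained at the midpoint, so it commutes with the factor `α(K)` whatever
    -- the value of that factor in `[0, ∞]`.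
    rw [mul_comm, mul_div_assoc]
    refine le_antisymm ((iInf_le _ (midpoint ℝ a b)).trans_eq ?_) (le_iInf fun z => ?_)
    · rw [hmid]
    · exact mul_le_mul_right (hlow z) _
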